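/- Let $n\ge 0$ and let $\mathcal A\subset\mathbb N^n$ be a finite set with $0\in\mathcal A$. For $f\in\mathbb C[x_1,\dots,x_n]$ and $u\in\mathbb C^n$, let $$\mathcal L_{f,u}(\lambda,x)=\bigl(f,\ \partial_1 f-\lambda(u_1-x_1),\ \dots,\ \partial_n f-\lambda(u_n-x_n)\bigr),$$ a system of $n+1$ polynomials in the $n+1$ variables $(\lambda,x_1,\dots,x_n)$. For $w\in\mathbb Z^{n+1}$ and a polynomial $g=\sum_{a\in\mathcal B}c_a z^a$ in $n+1$ variables with support $\mathcal B$ (so all $c_a\neq0$), let $g_w=\sum_{a\in\mathcal B_w}c_a z^a$, where $\mathcal B_w$ is the set of $a\in\mathcal B$ at which $a\mapsto w\cdot a$ attains its minimum over $\mathcal B$. The facial system $(\mathcal L_{f,u})_w$ is obtained by replacing each entry $g$ of $\mathcal L_{f,u}$ by $g_w$. Theorem 4.2. Suppose that $f$ is general given its support $\mathcal A$, and that $u\in\mathbb C^n$ is general. Then for every nonzero $w\in\mathbb Z^{n+1}$, the facial system $(\mathcal L_{f,u})_w$ has no solutions in $(\mathbb C^\times)^{n+1}$. Here "general" means lying outside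 a proper algebraic subvariety. That is, there is a proper algebraic subvariety $Z\subsetneq\mathbb C^{\mathcal A}$ such that for every $c\in\mathbb C^{\mathcal A}\smallsetminus Z$ the polynomial $f=\sum_{a\in\mathcal A}c_a x^a$ has support exactly $\mathcal A$, and there is a proper algebraic subvariety $Y_f\subsetneq\mathbb C^n$ such that for every $u\in\mathbb C^n\smallsetminus Y_f$ and every nonzero $w\in\mathbb Z^{n+1}$, the facial system $(\mathcal L_{f,u})_w$ has no solutions in $(\mathbb C^\times)^{n+1}$. -/

import Mathlib

namespace SparseED

/-- A (complex, affine) algebraic subvariety of `ℂ^σ`: the common zero set of a set of polynomials. -/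
def IsAlgebraicSubvariety {σ : Type*} (Z : Set (σ → ℂ)) : Prop :=
  ∃ S : Set (MvPolynomial σ ℂ), Z = {x | ∀ p ∈ S, MvPolynomial.eval x p = 0}

/-- `P` holds for general `x ∈ ℂ^σ`: it holds for all `x` in the complement of a proper algebraic
subvariety. For finite `σ`, such a complement is a dense (Zariski) open subset of `ℂ^σ`. -/
def HoldsForGeneral {σ : Type*} (P : (σ → ℂ) → Prop) : Prop :=
  ∃ Z : Set (σ → ℂ), IsAlgebraicSubvariety Z ∧ Z ≠ Set.univ ∧ ∀ x, x ∉ Z → P x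

/-- The polynomial `∑_{a ∈ A} c_a x^a` with coefficient vector `c ∈ ℂ^A`. -/
noncomputable def sparsePoly {n : ℕ} (A : Finset (Fin n →₀ ℕ)) (c : A → ℂ) :
    MvPolynomial (Fin n) ℂ :=
  ∑ a : A, MvPolynomial.monomial (a : Fin n →₀ ℕ) (c a)

/-- The value `w · a` of the weight `w` on the exponent `a`. -/
def weightAt {m : ℕ} (w : Fin m → ℤ) (a : Fin m →₀ ℕ) : ℤ :=
  ∑ i, w i * (a i : ℤ)

/-- The face `A_w` of `A` exposed by `w`: the elements of `A` at which `a ↦ w · a` attains its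
minimum over `A`. -/
def face {m : ℕ} (w : Fin m → ℤ) (A : Finset (Fin m →₀ ℕ)) : Finset (Fin m →₀ ℕ) :=
  A.filter fun a => ∀ b ∈ A, weightAt w a ≤ weightAt w b

/-- The restriction `g_w` of `g` to the face, exposed by `w`, of the support of `g`. -/
noncomputable def facialPart {m : ℕ} (w : Fin m → ℤ) (g : MvPolynomial (Fin m) ℂ) :
    MvPolynomial (Fin m) ℂ :=
  ∑ a ∈ face w g.support, MvPolynomial.monomial a (MvPolynomial.coeff a g)

/-- The facial system `G_w = ((g_1)_w, …, (g_k)_w)` of a system `G = (g_1, …, g_k)`. -/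
noncomputable def facialSystem {k m : ℕ} (w : Fin m → ℤ) (G : Fin k → MvPolynomial (Fin m) ℂ) :
    Fin k → MvPolynomial (Fin m) ℂ :=
  fun j => facialPart w (G j)

/-- The Lagrange multiplier equations `L_{f,u} = (f, ∂_1 f - λ (u_1 - x_1), …, ∂_n f - λ (u_n - x_n))`
in the variables `(λ, x_1, …, x_n)`. The variable `λ` has index `0`, and `x_i` has index `i.succ`. -/
noncomputable def lagrange {n : ℕ} (f : MvPolynomial (Fin n) ℂ) (u : Fin n → ℂ) :
    Fin (n + 1) → MvPolynomial (Fin (n + 1)) ℂ :=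
  Fin.cons (MvPolynomial.rename Fin.succ f) fun i =>
    MvPolynomial.rename Fin.succ (MvPolynomial.pderiv i f)
      - MvPolynomial.X 0 * (MvPolynomial.C (u i) - MvPolynomial.X i.succ)

/-- The system `G` has a solution in the algebraic torus `(ℂ^×)^m`. -/
def HasTorusSolution {k m : ℕ} (G : Fin k → MvPolynomial (Fin m) ℂ) : Prop :=
  ∃ z : Fin m → ℂ, (∀ i, z i ≠ 0) ∧ ∀ j, MvPolynomial.eval z (G j) = 0

end SparseED

/-!
Let `h` be the minimal weight of the monomials of `f`, so `h ≤ 0` because `0 ∈ A`. Write `w₀` for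
the weight of `λ` and `v i` for the weight of `x_i`, and let `(λ, x)` solve the facial system.

If `h < w₀`, the initial form `g` of `f` vanishes at `x` and its gradient there is `-λ x_i` where
`2 * v i = h - w₀` and `0` elsewhere. By Euler's identity `x` then lies on the quadric
`∑ x_i ^ 2 = 0` in those coordinates, to which `g` is thus tangent. By a Bertini argument this does
not happen for general coefficients: if it did it would happen at a point over a field in which the
coefficients are algebraically independent, and applying the derivation of that field which is `1`
on one coefficient and `0` on the others to `g(x) = 0` would show that the corresponding monomial
vanishes at `x`.

If `w₀ ≤ h`, the Lagrange equations force all `v i ≥ 0`. Let `x'` be `x` with the coordinates of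
positive weight set to zero. If `w₀ < 0`, then `x' = u`, and `f(u) = 0`. If `w₀ = 0`, then `x'` is a
critical point of the squared distance to `u` lying on a coordinate hyperplane, and the points `u`
admitting one have too small dimension.
-/

namespace SparseED

open MvPolynomial

section General

variable {σ ι : Type*} {P Q : (σ → ℂ) → Prop}

theorem holdsForGeneral_iff :
    HoldsForGeneral P ↔ ∃ p : MvPolynomial σ ℂ, p ≠ 0 ∧ ∀ x, eval x p ≠ 0 → P x := by
  constructor
  · rintro ⟨Z, ⟨S, rfl⟩, hZ, h⟩
    obtain ⟨x, hx⟩ := (Set.ne_univ_iff_exists_notMem _).1 hZ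
    simp only [Set.mem_ofPred_eq, not_forall] at hx
    obtain ⟨p, hp, hpx⟩ := hx
    exact ⟨p, fun h0 => hpx (by rw [h0, map_zero]), fun y hy => h y fun hmem => hy (hmem p hp)⟩
  · rintro ⟨p, hp, h⟩
    refine ⟨{x | eval x p = 0}, ⟨{p}, by simp⟩, fun hu => hp (MvPolynomial.funext fun x => ?_), h⟩
    rw [map_zero]
    exact Set.eq_univ_iff_forall.1 hu x

theorem holdsForGeneral_eval_ne_zero {p : MvPolynomial σ ℂ} (hp : p ≠ 0) :
    HoldsForGeneral fun x => eval x p ≠ 0 :=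
  holdsForGeneral_iff.2 ⟨p, hp, fun _ h => h⟩

theorem HoldsForGeneral.mono (hP : HoldsForGeneral P) (h : ∀ x, P x → Q x) :
    HoldsForGeneral Q := by
  obtain ⟨Z, hZ, hZ', hP⟩ := hP
  exact ⟨Z, hZ, hZ', fun x hx => h x (hP x hx)⟩

theorem HoldsForGeneral.forall [Finite ι] {P : ι → (σ → ℂ) → Prop}
    (h : ∀ i, HoldsForGeneral (P i)) : HoldsForGeneral fun x => ∀ i, P i x := by
  cases nonempty_fintype ι
  simp only [holdsForGeneral_iff] at h ⊢
  choose p hp h using h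
  refine ⟨∏ i, p i, Finset.prod_ne_zero_iff.2 fun i _ => hp i, fun x hx i => h i x ?_⟩
  rw [map_prod] at hx
  exact Finset.prod_ne_zero_iff.1 hx i (Finset.mem_univ i)

theorem HoldsForGeneral.and (hP : HoldsForGeneral P) (hQ : HoldsForGeneral Q) :
    HoldsForGeneral fun x => P x ∧ Q x := by
  obtain ⟨p, hp, hP⟩ := holdsForGeneral_iff.1 hP
  obtain ⟨q, hq, hQ⟩ := holdsForGeneral_iff.1 hQ
  refine holdsForGeneral_iff.2 ⟨p * q, mul_ne_zero hp hq, fun x hx => ?_⟩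
  rw [map_mul] at hx
  exact ⟨hP x (left_ne_zero_of_mul hx), hQ x (right_ne_zero_of_mul hx)⟩

theorem holdsForGeneral_forall_ne_zero [Finite σ] :
    HoldsForGeneral fun x : σ → ℂ => ∀ i, x i ≠ 0 :=
  .forall fun i => (holdsForGeneral_eval_ne_zero (X_ne_zero i)).mono fun x hx => by
    rwa [eval_X] at hx

end General

section Derivation

variable {ι σ k K : Type*} [Field k] [Field K] [Algebra k K]

theorem formallyEtale_of_isTranscendenceBasis [CharZero k] [Algebra (MvPolynomial ι k) K]
    [IsScalarTower k (MvPolynomial ι k) K]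
    (hv : IsTranscendenceBasis k fun i => algebraMap (MvPolynomial ι k) K (X i)) :
    Algebra.FormallyEtale (MvPolynomial ι k) K := by
  open scoped IntermediateField.algebraAdjoinAdjoin in
  set v : ι → K := fun i => algebraMap (MvPolynomial ι k) K (X i)
  let A := Algebra.adjoin k (Set.range v)
  let F := IntermediateField.adjoin k (Set.range v)
  have : Algebra.FormallyEtale A F := .of_isLocalization (nonZeroDivisors A)
  have : Algebra.IsAlgebraic F K := hv.isAlgebraic_field
  have : CharZero F := algebraRat.charZero F
  have : Algebra.FormallyEtale F K := .of_isSeparable F K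
  have : Algebra.FormallyEtale A K := .comp A F K
  let e := hv.1.aevalEquiv
  let _ : Algebra (MvPolynomial ι k) A := e.toRingHom.toAlgebra
  have : Algebra.FormallyEtale (MvPolynomial ι k) A :=
    .of_equiv (A := MvPolynomial ι k) { e.toRingEquiv with commutes' := fun _ => rfl }
  have : IsScalarTower (MvPolynomial ι k) A K := .of_algebraMap_eq fun p => by
    refine Eq.trans ?_ (hv.1.algebraMap_aevalEquiv p).symm
    exact DFunLike.congr_fun (aeval_unique (IsScalarTower.toAlgHom k (MvPolynomial ι k) K)) p
  exact .comp (MvPolynomial ι k) A K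

theorem exists_derivation_of_isTranscendenceBasis [CharZero k] {v : ι → K}
    (hv : IsTranscendenceBasis k v) (g : ι → K) : ∃ D : Derivation k K K, ∀ i, D (v i) = g i := by
  let _ : Algebra (MvPolynomial ι k) K := (aeval (R := k) v).toRingHom.toAlgebra
  have : IsScalarTower k (MvPolynomial ι k) K :=
    .of_algebraMap_eq fun r => ((aeval (R := k) v).commutes r).symm
  have hX (i) : algebraMap (MvPolynomial ι k) K (X i) = v i := aeval_X v i
  have : Algebra.FormallyEtale (MvPolynomial ι k) K :=
    formallyEtale_of_isTranscendenceBasis (by rwa [funext hX])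
  let e := KaehlerDifferential.tensorKaehlerEquivOfFormallyEtale k (MvPolynomial ι k) K
  let l := LinearMap.liftBaseChange K (mkDerivation k g).liftKaehlerDifferential
  refine ⟨(l ∘ₗ e.symm.toLinearMap).compDer (KaehlerDifferential.D k K), fun i => ?_⟩
  have he := KaehlerDifferential.tensorKaehlerEquivOfFormallyEtale_symm_D_algebraMap
    k (MvPolynomial ι k) K (X i)
  rw [hX] at he
  simp [e, he, l]

theorem exists_derivation_of_algebraicIndependent [CharZero k] {c : ι → K}
    (hc : AlgebraicIndependent k c) (g : ι → K) : ∃ D : Derivation k K K, ∀ i, D (c i) = g i := by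
  obtain ⟨s, hs, hcs⟩ := exists_isTranscendenceBasis_superset (R := k)
    ((algebraicIndependent_subtype_range hc.injective).2 hc)
  obtain ⟨D, hD⟩ := exists_derivation_of_isTranscendenceBasis hcs
    fun x => Function.extend c g 0 (x : K)
  exact ⟨D, fun i => by simpa [hc.injective.extend_apply] using hD ⟨c i, hs ⟨i, rfl⟩⟩⟩

end Derivation

theorem derivation_aeval {σ R A : Type*} [Fintype σ] [CommRing R] [CommRing A] [Algebra R A]
    (D : Derivation R A A) (x : σ → A) (p : MvPolynomial σ R) :
    D (aeval x p) = ∑ i, aeval x (pderiv i p) * D (x i) := by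
  classical
  induction p using MvPolynomial.induction_on with
  | C a => simp
  | add p q hp hq => simp only [map_add, hp, hq, add_mul, Finset.sum_add_distrib]
  | mul_X p i hp =>
    have hX (j) : aeval x (pderiv j (X i : MvPolynomial σ R)) = if i = j then 1 else 0 := by
      rw [pderiv_X, Pi.single_apply, apply_ite (aeval x), map_one, map_zero]
    simp only [map_mul, aeval_X, Derivation.leibniz, smul_eq_mul, hp, map_add, hX, add_mul,
      Finset.sum_add_distrib, Finset.mul_sum, mul_ite, mul_one, mul_zero, ite_mul, zero_mul,
      Finset.sum_ite_eq, Finset.mem_univ, if_true, mul_assoc]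

universe u v

-- Otherwise some prime containing `S` avoids `g` and all nonzero polynomials in `c`, and the
-- fraction field of its quotient contradicts `h`.
theorem holdsForGeneral_of_generic {σ : Type u} {τ : Type v} (S : Set (MvPolynomial (σ ⊕ τ) ℂ))
    (g : MvPolynomial (σ ⊕ τ) ℂ)
    (h : ∀ (K : Type max u v) [Field K] [Algebra ℂ K] (c : σ → K) (y : τ → K),
      AlgebraicIndependent ℂ c → (∀ p ∈ S, aeval (Sum.elim c y) p = 0) →
        aeval (Sum.elim c y) g = 0) :
    HoldsForGeneral fun c : σ → ℂ => ∀ y : τ → ℂ,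
      (∀ p ∈ S, aeval (Sum.elim c y) p = 0) → aeval (Sum.elim c y) g = 0 := by
  let incl : MvPolynomial σ ℂ →ₐ[ℂ] MvPolynomial (σ ⊕ τ) ℂ := rename Sum.inl
  let M := (nonZeroDivisors (MvPolynomial σ ℂ)).map incl ⊔ Submonoid.powers g
  by_cases hM : Disjoint (Ideal.span S : Set (MvPolynomial (σ ⊕ τ) ℂ)) M
  · exfalso
    obtain ⟨Q, hQ, hSQ, hMQ⟩ := Ideal.exists_le_prime_disjoint _ _ hM
    let φ : MvPolynomial (σ ⊕ τ) ℂ →ₐ[ℂ] FractionRing (MvPolynomial (σ ⊕ τ) ℂ ⧸ Q) :=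
      (IsScalarTower.toAlgHom ℂ (MvPolynomial (σ ⊕ τ) ℂ ⧸ Q) _).comp (Ideal.Quotient.mkₐ ℂ Q)
    have hφ (p) : φ p = 0 ↔ p ∈ Q :=
      (FaithfulSMul.algebraMap_eq_zero_iff (MvPolynomial (σ ⊕ τ) ℂ ⧸ Q) _).trans
        Ideal.Quotient.eq_zero_iff_mem
    have hφM {p} (hp : p ∈ M) : φ p ≠ 0 := fun h0 =>
      Set.disjoint_right.1 hMQ hp ((hφ p).1 h0)
    have hφX : aeval (Sum.elim (fun a => φ (X (.inl a))) fun b => φ (X (.inr b))) = φ := by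
      ext (a | b) <;> simp
    refine hφM (p := g) (Submonoid.mem_sup_right (Submonoid.mem_powers g)) ?_
    rw [← hφX]
    refine h _ _ _ (algebraicIndependent_iff.2 fun p hp => ?_) fun p hp => ?_
    · by_contra hp0
      refine hφM (Submonoid.mem_sup_left ⟨p, mem_nonZeroDivisors_of_ne_zero hp0, rfl⟩) ?_
      rw [← hφX]
      exact (aeval_rename ..).trans hp
    · rw [hφX, hφ]
      exact hSQ (Ideal.subset_span hp)
  · obtain ⟨_, hS, hM⟩ := Set.not_disjoint_iff.1 hM
    obtain ⟨_, ⟨p, hp, rfl⟩, _, ⟨m, rfl⟩, rfl⟩ := Submonoid.mem_sup.1 hM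
    refine holdsForGeneral_iff.2 ⟨p, nonZeroDivisors.ne_zero hp, fun c hc y hy => ?_⟩
    have hle : Ideal.span S ≤ RingHom.ker (aeval (R := ℂ) (Sum.elim c y)) := Ideal.span_le.2 hy
    have hz : aeval c p * aeval (Sum.elim c y) g ^ m = 0 := by
      have := hle hS
      rwa [RingHom.mem_ker, map_mul, map_pow, aeval_rename] at this
    exact eq_zero_of_pow_eq_zero ((mul_eq_zero.1 hz).resolve_left hc)

section Bertini

/-- The hypersurfaces `f = 0` and `q = 0` meet tangentially at `x`. We allow `s = 0`, so this
includes the case that `x` is a singular point of `f = 0` lying on `q = 0`. -/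
def IsTangentAt {σ R : Type*} [CommRing R] (f q : MvPolynomial σ R) (x : σ → R) : Prop :=
  eval x f = 0 ∧ eval x q = 0 ∧ ∃ s, ∀ i, eval x (pderiv i f) = s * eval x (pderiv i q)

-- Apply to `∑ b, c b * p b (x) = 0` a derivation `D` with `D (c a) = 1` and `D (c b) = 0` for
-- `b ≠ a`: the terms containing some `D (x i)` add up to `s * D (q (x)) = 0`.
theorem aeval_eq_zero_of_tangent {ι σ k K : Type*} [Fintype ι] [Finite σ] [Field k] [CharZero k]
    [Field K] [Algebra k K] {c : ι → K} (hc : AlgebraicIndependent k c) {p : ι → MvPolynomial σ k}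
    {q : MvPolynomial σ k} {x : σ → K} {s : K} (hf : ∑ a, c a * aeval x (p a) = 0)
    (hq : aeval x q = 0)
    (hs : ∀ i, ∑ a, c a * aeval x (pderiv i (p a)) = s * aeval x (pderiv i q)) (a : ι) :
    aeval x (p a) = 0 := by
  classical
  cases nonempty_fintype σ
  obtain ⟨D, hD⟩ := exists_derivation_of_algebraicIndependent hc (Pi.single a 1)
  have hDc : ∑ b, aeval x (p b) * D (c b) = aeval x (p a) := by
    simp [hD, Pi.single_apply]
  have hDx : ∑ b, c b * D (aeval x (p b)) = 0 :=
    calc ∑ b, c b * D (aeval x (p b))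
        = ∑ i, (∑ b, c b * aeval x (pderiv i (p b))) * D (x i) := by
          simp only [derivation_aeval, Finset.mul_sum, Finset.sum_mul, mul_assoc]
          exact Finset.sum_comm
      _ = s * D (aeval x q) := by
          simp only [hs, derivation_aeval, Finset.mul_sum, mul_assoc]
      _ = 0 := by rw [hq, map_zero, mul_zero]
  have hDf := congrArg D hf
  simpa only [map_sum, map_zero, Derivation.leibniz, smul_eq_mul, Finset.sum_add_distrib, hDx, hDc,
    zero_add] using hDf

/-- The system expressing that `∑ a, c a * p a` and `q` are tangent at `x`, in the parameters `c`
and the unknowns `s` (with index `none`) and `x` (with index `some i`). -/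
noncomputable def tangencySystem {ι σ R : Type*} [Fintype ι] [CommRing R]
    (p : ι → MvPolynomial σ R) (q : MvPolynomial σ R) : Set (MvPolynomial (ι ⊕ Option σ) R) :=
  {∑ a, X (.inl a) * rename (.inr ∘ some) (p a), rename (.inr ∘ some) q} ∪
    Set.range fun i => ∑ a, X (.inl a) * rename (.inr ∘ some) (pderiv i (p a)) -
      X (.inr none) * rename (.inr ∘ some) (pderiv i q)

theorem forall_mem_tangencySystem {ι σ R A : Type*} [Fintype ι] [CommRing R] [CommRing A]
    [Algebra R A] {p : ι → MvPolynomial σ R} {q : MvPolynomial σ R} {c : ι → A}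
    {y : Option σ → A} :
    (∀ r ∈ tangencySystem p q, aeval (Sum.elim c y) r = 0) ↔
      ∑ a, c a * aeval (y ∘ some) (p a) = 0 ∧ aeval (y ∘ some) q = 0 ∧
        ∀ i, ∑ a, c a * aeval (y ∘ some) (pderiv i (p a)) =
          y none * aeval (y ∘ some) (pderiv i q) := by
  have hy : Sum.elim c y ∘ .inr ∘ some = y ∘ some := rfl
  simp [tangencySystem, or_imp, forall_and, aeval_rename, hy, sub_eq_zero, and_assoc]

theorem holdsForGeneral_eval_eq_zero_of_isTangentAt {ι σ : Type*} [Fintype ι] [Finite σ]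
    (p : ι → MvPolynomial σ ℂ) (q : MvPolynomial σ ℂ) :
    HoldsForGeneral fun c : ι → ℂ => ∀ x, IsTangentAt (∑ a, c a • p a) q x →
      ∀ a, eval x (p a) = 0 := by
  have hgen (a) := holdsForGeneral_of_generic (tangencySystem p q) (rename (.inr ∘ some) (p a))
    fun K _ _ c y hc h => by
      obtain ⟨hf, hq, hs⟩ := forall_mem_tangencySystem.1 h
      rw [aeval_rename]
      exact aeval_eq_zero_of_tangent hc hf hq hs a
  refine (HoldsForGeneral.forall hgen).mono ?_
  rintro c hc x ⟨hf, hq, s, hs⟩ a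
  let y : Option σ → ℂ := fun o => o.elim s x
  have hy : y ∘ some = x := rfl
  have hyn : y none = s := rfl
  have := hc a y (forall_mem_tangencySystem.2 ⟨?_, hq, fun i => ?_⟩)
  · rwa [aeval_rename] at this
  · simpa [smul_eval, hy] using hf
  · simpa [smul_eval, hy, hyn] using hs i

end Bertini

section CriticalPoint

theorem exists_ne_zero_dvd_aeval {ι σ k : Type*} [Field k] [Finite σ] [Finite ι]
    (h : Nat.card σ ≤ Nat.card ι) (φ : ι → MvPolynomial σ k) {g : MvPolynomial σ k} (hg : g ≠ 0) :
    ∃ p : MvPolynomial ι k, p ≠ 0 ∧ g ∣ aeval φ p := by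
  by_cases hφ : AlgebraicIndependent k φ
  · have hφ' : IsTranscendenceBasis k φ := by
      refine hφ.isTranscendenceBasis_of_lift_trdeg_le_of_finite ?_
      rw [MvPolynomial.trdeg_of_isDomain, ← Nat.cast_card, ← Nat.cast_card]
      simpa using h
    have : Algebra.IsAlgebraic (Algebra.adjoin k (Set.range φ)) (MvPolynomial σ k) :=
      hφ'.isAlgebraic
    obtain ⟨⟨r, hr⟩, hr0, hgr⟩ := IsAlgebraic.exists_nonzero_dvd
      (Algebra.IsAlgebraic.isAlgebraic (R := Algebra.adjoin k (Set.range φ)) g)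
      (mem_nonZeroDivisors_of_ne_zero hg)
    rw [Algebra.adjoin_range_eq_range_aeval] at hr
    obtain ⟨p, rfl⟩ := hr
    refine ⟨p, fun hp => hr0 ?_, hgr⟩
    ext1
    simp [hp]
  · rw [algebraicIndependent_iff] at hφ
    push Not at hφ
    obtain ⟨p, hp, hp0⟩ := hφ
    exact ⟨p, hp0, hp ▸ dvd_zero g⟩

theorem eval_aeval {σ τ R : Type*} [CommSemiring R] (y : τ → R) (φ : σ → MvPolynomial τ R)
    (p : MvPolynomial σ R) : eval y (aeval φ p) = eval (fun i => eval y (φ i)) p := by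
  simpa only [aeval_eq_eval, RingHom.coe_coe] using comp_aeval_apply φ (aeval y) p

/-- `x` is a critical point, with nonzero Lagrange multiplier, of the squared distance to `u` on
the hypersurface `f = 0`. -/
def IsCriticalPoint {σ R : Type*} [CommRing R] (f : MvPolynomial σ R) (u x : σ → R) : Prop :=
  eval x f = 0 ∧ ∃ l ≠ 0, ∀ i, eval x (pderiv i f) = l * (u i - x i)

-- A critical point `x` with `x i = 0` lies on the restriction `g` of `f` to `x i = 0` and satisfies
-- `u j = x j + l⁻¹ * ∂f/∂x j`. Reusing the variable `x i` for `l⁻¹` makes `u` the image of a point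
-- of `g = 0` under a polynomial map `φ`, and the image of a hypersurface is not dense.
theorem holdsForGeneral_criticalPoint_coord_ne_zero {σ : Type*} [Finite σ] {f : MvPolynomial σ ℂ}
    (hf : eval 0 f ≠ 0) :
    HoldsForGeneral fun u : σ → ℂ => ∀ x, IsCriticalPoint f u x → ∀ i, x i ≠ 0 := by
  classical
  suffices h : ∀ i, HoldsForGeneral fun u : σ → ℂ => ∀ x, IsCriticalPoint f u x → x i ≠ 0 from
    (HoldsForGeneral.forall h).mono fun u hu x hx i => hu i x hx
  intro i
  let restr : MvPolynomial σ ℂ →ₐ[ℂ] MvPolynomial σ ℂ := aeval (Function.update X i 0)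
  let φ (j : σ) : MvPolynomial σ ℂ := restr (X j) + X i * restr (pderiv j f)
  have hrestr (y : σ → ℂ) (r) : eval y (restr r) = eval (Function.update y i 0) r := by
    rw [eval_aeval]
    congr! 2
    ext j
    rw [Function.apply_update (fun _ => eval y)]
    simp
  have hg : restr f ≠ 0 := fun h => hf <| by
    rw [← Function.update_eq_self i (0 : σ → ℂ), Pi.zero_apply, ← hrestr, h, map_zero]
  obtain ⟨p, hp, hgp⟩ := exists_ne_zero_dvd_aeval le_rfl φ hg
  refine (holdsForGeneral_eval_ne_zero hp).mono ?_
  rintro u hu x ⟨hfx, l, hl, hcrit⟩ hxi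
  let y := Function.update x i l⁻¹
  have hy : Function.update y i 0 = x := by
    rw [Function.update_idem, ← hxi, Function.update_eq_self]
  have hφ : (fun j => eval y (φ j)) = u := by
    ext j
    have : eval y (X i) = l⁻¹ := by simp [y]
    rw [map_add, map_mul, hrestr, hrestr, hy, eval_X, this, hcrit, inv_mul_cancel_left₀ hl,
      add_sub_cancel]
  apply hu
  have hgy : eval y (restr f) ∣ eval y (aeval φ p) := map_dvd _ hgp
  rw [hrestr, hy, hfx, zero_dvd_iff] at hgy
  rwa [eval_aeval, hφ] at hgy

end CriticalPoint

section Weight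

variable {σ τ R M : Type*} [CommSemiring R]

theorem weight_mapDomain [AddCommMonoid M] (w : τ → M) (φ : σ → τ) (a : σ →₀ ℕ) :
    Finsupp.weight w (a.mapDomain φ) = Finsupp.weight (w ∘ φ) a := by
  induction a using Finsupp.induction_linear with
  | zero => simp
  | add a b ha hb => simp only [Finsupp.mapDomain_add, map_add, ha, hb]
  | single i k => simp [Finsupp.weight_single]

theorem weightedHomogeneousComponent_monomial [AddCommMonoid M] [DecidableEq M] (w : σ → M) (m : M)
    (a : σ →₀ ℕ) (r : R) : weightedHomogeneousComponent w m (monomial a r) =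
      if Finsupp.weight w a = m then monomial a r else 0 := by
  rw [weightedHomogeneousComponent_of_mem (isWeightedHomogeneous_monomial w a r rfl)]
  simp only [eq_comm]

theorem weightedHomogeneousComponent_rename [AddCommMonoid M] (w : τ → M) (m : M) (φ : σ → τ)
    (p : MvPolynomial σ R) : weightedHomogeneousComponent w m (rename φ p) =
      rename φ (weightedHomogeneousComponent (w ∘ φ) m p) := by
  classical
  induction p using MvPolynomial.induction_on' with
  | add p q hp hq => simp only [map_add, hp, hq]
  | monomial a r =>
    simp only [rename_monomial, weightedHomogeneousComponent_monomial, weight_mapDomain,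
      apply_ite (rename φ), map_zero]

theorem weightedHomogeneousComponent_pderiv [AddCancelCommMonoid M] (w : σ → M) (m : M) (i : σ)
    (p : MvPolynomial σ R) : weightedHomogeneousComponent w m (pderiv i p) =
      pderiv i (weightedHomogeneousComponent w (m + w i) p) := by
  classical
  ext a
  simp only [coeff_weightedHomogeneousComponent, coeff_pderiv, map_add, Finsupp.weight_single,
    one_smul, add_left_inj, ite_mul, zero_mul]

section WeightGE

variable [AddCommMonoid M] [Preorder M]

variable (R) in
/-- The polynomials all of whose monomials have weight at least `m`. -/
noncomputable def weightGE (w : σ → M) (m : M) : Submodule R (MvPolynomial σ R) :=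
  restrictSupport R {a | m ≤ Finsupp.weight w a}

theorem mem_weightGE_iff {w : σ → M} {m : M} {p : MvPolynomial σ R} :
    p ∈ weightGE R w m ↔ ∀ a ∈ p.support, m ≤ Finsupp.weight w a :=
  .rfl

theorem weightGE_antitone (w : σ → M) : Antitone (weightGE R w) := fun _ _ h =>
  restrictSupport_mono R fun _ ha => h.trans ha

theorem weightGE_zero_eq_top [IsOrderedAddMonoid M] {w : σ → M} (hw : ∀ i, 0 ≤ w i) :
    weightGE R w 0 = ⊤ :=
  (Submodule.eq_top_iff').2 fun _ => mem_weightGE_iff.2 fun a _ => by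
    rw [Finsupp.weight_apply]
    exact Finsupp.sum_nonneg fun i _ => nsmul_nonneg (hw i) _

theorem monomial_mem_weightGE {w : σ → M} {m : M} {a : σ →₀ ℕ} (h : m ≤ Finsupp.weight w a)
    (r : R) : monomial a r ∈ weightGE R w m :=
  (monomial_mem_restrictSupport R).2 (.inl h)

theorem rename_mem_weightGE {w : τ → M} {m : M} {φ : σ → τ} {p : MvPolynomial σ R}
    (hp : p ∈ weightGE R (w ∘ φ) m) : rename φ p ∈ weightGE R w m := by
  rw [p.as_sum, map_sum]
  refine Submodule.sum_mem _ fun a ha => ?_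
  rw [rename_monomial]
  exact monomial_mem_weightGE ((hp ha).trans_eq (weight_mapDomain w φ a).symm) _

theorem pderiv_mem_weightGE {M : Type*} [AddCommGroup M] [Preorder M] [IsOrderedAddMonoid M]
    {w : σ → M} {m : M} {p : MvPolynomial σ R} (hp : p ∈ weightGE R w m) (i : σ) :
    pderiv i p ∈ weightGE R w (m - w i) := by
  refine mem_weightGE_iff.2 fun a ha => ?_
  rw [mem_support_iff, coeff_pderiv] at ha
  have := hp (mem_support_iff.2 (left_ne_zero_of_mul ha))
  rwa [Set.mem_ofPred_eq, map_add, Finsupp.weight_single, one_smul, ← sub_le_iff_le_add] at this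

theorem weightedHomogeneousComponent_eq_zero_of_mem_weightGE {w : σ → M} {m k : M}
    {p : MvPolynomial σ R} (hp : p ∈ weightGE R w k) (hm : m < k) :
    weightedHomogeneousComponent w m p = 0 :=
  weightedHomogeneousComponent_eq_zero' m p fun _ ha => (hm.trans_le (hp ha)).ne'

end WeightGE

theorem exists_weightedHomogeneousComponent_ne_zero [AddCommMonoid M] [LinearOrder M] (w : σ → M)
    {p : MvPolynomial σ R} (hp : p ≠ 0) :
    ∃ m, p ∈ weightGE R w m ∧ weightedHomogeneousComponent w m p ≠ 0 := by
  obtain ⟨a, ha, hmin⟩ := p.support.exists_min_image (Finsupp.weight w) (support_nonempty.2 hp)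
  refine ⟨_, mem_weightGE_iff.2 hmin, ne_zero_iff.2 ⟨a, ?_⟩⟩
  rwa [coeff_weightedHomogeneousComponent, if_pos rfl, ← mem_support_iff]

theorem eval_weightedHomogeneousComponent_zero [AddCommMonoid M] [PartialOrder M]
    [IsOrderedAddMonoid M] [IsAddTorsionFree M] [DecidableEq M] {w : σ → M} (hw : ∀ i, 0 ≤ w i)
    (x : σ → R) (p : MvPolynomial σ R) :
    eval x (weightedHomogeneousComponent w 0 p) = eval (fun i => if w i = 0 then x i else 0) p := by
  induction p using MvPolynomial.induction_on' with
  | add p q hp hq => simp only [map_add, hp, hq]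
  | monomial a r =>
    have hwa : Finsupp.weight w a = 0 ↔ ∀ i ∈ a.support, w i = 0 := by
      rw [Finsupp.weight_apply, Finsupp.sum,
        Finset.sum_eq_zero_iff_of_nonneg fun i _ => nsmul_nonneg (hw i) _]
      refine forall₂_congr fun i hi => ?_
      rw [smul_eq_zero, or_iff_right (Finsupp.mem_support_iff.1 hi)]
    rw [weightedHomogeneousComponent_monomial, apply_ite (eval x), map_zero, eval_monomial,
      eval_monomial]
    split_ifs with h
    · exact congrArg (r * ·) (Finsupp.prod_congr fun i hi => by rw [if_pos (hwa.1 h i hi)])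
    · rw [hwa] at h
      push Not at h
      obtain ⟨i, hi, hwi⟩ := h
      rw [Finsupp.prod, Finset.prod_eq_zero hi, mul_zero]
      rw [if_neg hwi, zero_pow (Finsupp.mem_support_iff.1 hi)]

theorem sum_weight_smul_X_mul_pderiv {σ R : Type*} [CommRing R] [Fintype σ] {w : σ → ℤ} {m : ℤ}
    {p : MvPolynomial σ R} (hp : p.IsWeightedHomogeneous w m) :
    ∑ i, w i • (X i * pderiv i p) = m • p := by
  induction hp using IsWeightedHomogeneous.induction_on with
  | zero => simp only [map_zero, mul_zero, smul_zero, Finset.sum_const_zero]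
  | add p q _ _ hp hq => simp only [map_add, mul_add, smul_add, Finset.sum_add_distrib, hp, hq]
  | monomial a r ha =>
    simp only [X_mul_pderiv_monomial, ← natCast_zsmul, smul_smul, ← Finset.sum_smul]
    rw [← ha, Finsupp.weight_eq_sum]
    simp only [nsmul_eq_mul, mul_comm]

end Weight

section Facial

variable {n : ℕ}

theorem weightAt_eq_weight (w : Fin n → ℤ) (a : Fin n →₀ ℕ) :
    weightAt w a = Finsupp.weight w a := by
  simp only [weightAt, Finsupp.weight_eq_sum, nsmul_eq_mul, mul_comm]

theorem facialPart_eq_weightedHomogeneousComponent {w : Fin n → ℤ} {m : ℤ}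
    {g : MvPolynomial (Fin n) ℂ} (hg : g ∈ weightGE ℂ w m)
    (hne : weightedHomogeneousComponent w m g ≠ 0) :
    facialPart w g = weightedHomogeneousComponent w m g := by
  obtain ⟨b, hb⟩ := ne_zero_iff.1 hne
  rw [coeff_weightedHomogeneousComponent, ite_ne_right_iff, ← mem_support_iff] at hb
  rw [facialPart, weightedHomogeneousComponent_apply, face]
  congr 1
  refine Finset.filter_congr fun a ha => ?_
  simp only [weightAt_eq_weight]
  exact ⟨fun h => le_antisymm ((h b hb.2).trans_eq hb.1) (hg ha), fun h c hc => h ▸ hg hc⟩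

theorem eval_weightedHomogeneousComponent_of_eval_facialPart {w : Fin n → ℤ} {m : ℤ}
    {g : MvPolynomial (Fin n) ℂ} (hg : g ∈ weightGE ℂ w m) {z : Fin n → ℂ}
    (hz : eval z (facialPart w g) = 0) : eval z (weightedHomogeneousComponent w m g) = 0 := by
  by_cases hne : weightedHomogeneousComponent w m g = 0
  · rw [hne, map_zero]
  · rwa [← facialPart_eq_weightedHomogeneousComponent hg hne]

theorem lagrange_succ_eq (f : MvPolynomial (Fin n) ℂ) (u : Fin n → ℂ) (i : Fin n) :
    lagrange f u i.succ = rename Fin.succ (pderiv i f) - monomial (Finsupp.single 0 1) (u i) +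
      monomial (Finsupp.single 0 1 + Finsupp.single i.succ 1) 1 := by
  have hu : (X 0 * C (u i) : MvPolynomial (Fin (n + 1)) ℂ) =
      monomial (Finsupp.single 0 1) (u i) := by
    rw [mul_comm, C_mul_X_eq_monomial]
  have hx : (X 0 * X i.succ : MvPolynomial (Fin (n + 1)) ℂ) =
      monomial (Finsupp.single 0 1 + Finsupp.single i.succ 1) 1 := by
    rw [X, X, monomial_mul, one_mul]
  rw [lagrange, Fin.cons_succ, mul_sub, hu, hx, sub_add]

/-- `(l, x)` is a solution in the torus of the facial system of `L_{f,u}` for the weight `w₀` of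
`λ` and the weights `v` of the `x_i`. -/
structure IsFacialSolution (f : MvPolynomial (Fin n) ℂ) (u : Fin n → ℂ) (w₀ : ℤ) (v : Fin n → ℤ)
    (l : ℂ) (x : Fin n → ℂ) : Prop where
  multiplier_ne_zero : l ≠ 0
  coord_ne_zero : ∀ i, x i ≠ 0
  eval_eq_zero : ∀ j,
    eval (Fin.cons l x : Fin (n + 1) → ℂ) (facialSystem (Fin.cons w₀ v) (lagrange f u) j) = 0

theorem hasTorusSolution_facialSystem_lagrange_iff {f : MvPolynomial (Fin n) ℂ} {u : Fin n → ℂ}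
    {w : Fin (n + 1) → ℤ} : HasTorusSolution (facialSystem w (lagrange f u)) ↔
      ∃ l x, IsFacialSolution f u (w 0) (Fin.tail w) l x := by
  constructor
  · rintro ⟨z, hz, h⟩
    refine ⟨z 0, Fin.tail z, hz 0, fun i => hz i.succ, ?_⟩
    simpa only [Fin.cons_self_tail] using h
  · rintro ⟨l, x, hl, hx, h⟩
    refine ⟨Fin.cons l x, Fin.cases hl hx, ?_⟩
    simpa only [Fin.cons_self_tail] using h

namespace IsFacialSolution

variable {f : MvPolynomial (Fin n) ℂ} {u x : Fin n → ℂ} {w₀ h : ℤ} {v : Fin n → ℤ} {l : ℂ}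

theorem eval_component (hs : IsFacialSolution f u w₀ v l x) (hf : f ∈ weightGE ℂ v h) :
    eval x (weightedHomogeneousComponent v h f) = 0 := by
  have := eval_weightedHomogeneousComponent_of_eval_facialPart
    (rename_mem_weightGE (w := (Fin.cons w₀ v : Fin (n + 1) → ℤ)) (φ := Fin.succ) hf)
    (hs.eval_eq_zero 0)
  rwa [weightedHomogeneousComponent_rename, eval_rename, Fin.cons_comp_succ, Fin.cons_comp_succ]
    at this

theorem eval_component_pderiv (hs : IsFacialSolution f u w₀ v l x) {i : Fin n} {m : ℤ}
    (hf : pderiv i f ∈ weightGE ℂ v m) (h₀ : m ≤ w₀) (hi : m ≤ w₀ + v i) :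
    eval x (weightedHomogeneousComponent v m (pderiv i f)) =
      l * ((if w₀ = m then u i else 0) - if w₀ + v i = m then x i else 0) := by
  let w : Fin (n + 1) → ℤ := Fin.cons w₀ v
  have hwu : Finsupp.weight w (Finsupp.single 0 1) = w₀ := by
    rw [Finsupp.weight_single, one_smul]
    rfl
  have hwx : Finsupp.weight w (Finsupp.single 0 1 + Finsupp.single i.succ 1 : Fin (n + 1) →₀ ℕ) =
      w₀ + v i := by
    rw [map_add, hwu, Finsupp.weight_single, one_smul]
    rfl
  have hmem : lagrange f u i.succ ∈ weightGE ℂ w m := by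
    rw [lagrange_succ_eq]
    exact add_mem (sub_mem (rename_mem_weightGE hf) (monomial_mem_weightGE (hwu ▸ h₀) _))
      (monomial_mem_weightGE (hwx ▸ hi) _)
  have := eval_weightedHomogeneousComponent_of_eval_facialPart hmem (hs.eval_eq_zero i.succ)
  rw [lagrange_succ_eq, map_add, map_sub, weightedHomogeneousComponent_rename,
    weightedHomogeneousComponent_monomial, weightedHomogeneousComponent_monomial, hwu, hwx,
    map_add, map_sub, eval_rename, Fin.cons_comp_succ, Fin.cons_comp_succ] at this
  have hlu : eval (Fin.cons l x : Fin (n + 1) → ℂ) (monomial (Finsupp.single 0 1) (u i)) =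
      l * u i := by
    simp [eval_monomial, mul_comm]
  have hlx : eval (Fin.cons l x : Fin (n + 1) → ℂ)
      (monomial (Finsupp.single 0 1 + Finsupp.single i.succ 1) 1) = l * x i := by
    simp [eval_monomial, Finsupp.prod_add_index', pow_add]
  rw [apply_ite (eval _), apply_ite (eval _), hlu, hlx, map_zero, sub_add, sub_eq_zero] at this
  rw [this, mul_sub, mul_ite, mul_ite, mul_zero]

-- Otherwise `λ x_i` would be the only term of minimal weight of its Lagrange equation.
theorem le_add_of_neg (hs : IsFacialSolution f u w₀ v l x) {i : Fin n}
    (hf : pderiv i f ∈ weightGE ℂ v h) (hi : v i < 0) : h ≤ w₀ + v i := by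
  by_contra! hlt
  have := hs.eval_component_pderiv (weightGE_antitone v hlt.le hf) (by lia) le_rfl
  rw [weightedHomogeneousComponent_eq_zero_of_mem_weightGE hf hlt, map_zero, if_neg (by lia),
    if_pos rfl, zero_sub, zero_eq_mul, neg_eq_zero] at this
  exact this.elim hs.multiplier_ne_zero (hs.coord_ne_zero i)

theorem weight_nonneg (hs : IsFacialSolution f u w₀ v l x) (hf : f ∈ weightGE ℂ v h)
    (hw : w₀ ≤ h) (i : Fin n) : 0 ≤ v i := by
  by_contra! hi
  have := hs.le_add_of_neg (pderiv_mem_weightGE hf i) hi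
  lia

theorem eval_eq_zero_of_neg (hs : IsFacialSolution f u w₀ v l x) (hv : ∀ i, 0 ≤ v i)
    (hw : w₀ < 0) : eval u f = 0 := by
  have hmem (p) : p ∈ weightGE ℂ v 0 := weightGE_zero_eq_top (R := ℂ) hv ▸ Submodule.mem_top
  have hux (i) : u i = if v i = 0 then x i else 0 := by
    have := hs.eval_component_pderiv (i := i) (weightGE_antitone v hw.le (hmem _)) le_rfl
      (le_add_of_nonneg_right (hv i))
    rw [weightedHomogeneousComponent_eq_zero_of_mem_weightGE (hmem _) hw, map_zero, if_pos rfl,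
      zero_eq_mul, or_iff_right hs.multiplier_ne_zero, sub_eq_zero] at this
    simpa only [add_eq_left] using this
  rw [funext hux, ← eval_weightedHomogeneousComponent_zero hv]
  exact hs.eval_component (hmem f)

theorem isCriticalPoint (hs : IsFacialSolution f u 0 v l x) (hv : ∀ i, 0 ≤ v i) :
    IsCriticalPoint f u fun i => if v i = 0 then x i else 0 := by
  have hmem (p) : p ∈ weightGE ℂ v 0 := weightGE_zero_eq_top (R := ℂ) hv ▸ Submodule.mem_top
  refine ⟨?_, l, hs.multiplier_ne_zero, fun i => ?_⟩
  · rw [← eval_weightedHomogeneousComponent_zero hv]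
    exact hs.eval_component (hmem f)
  · rw [← eval_weightedHomogeneousComponent_zero hv,
      hs.eval_component_pderiv (hmem _) le_rfl (by simpa using hv i), if_pos rfl]
    simp only [zero_add]

theorem eval_pderiv_component (hs : IsFacialSolution f u w₀ v l x) (hf : f ∈ weightGE ℂ v h)
    (hw : h < w₀) (i : Fin n) :
    eval x (pderiv i (weightedHomogeneousComponent v h f)) =
      if 2 * v i = h - w₀ then -l * x i else 0 := by
  have hfi := pderiv_mem_weightGE hf i
  have hle : h - v i ≤ w₀ + v i := by
    rcases lt_or_ge (v i) 0 with hi | hi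
    · exact hs.le_add_of_neg hfi hi
    · lia
  have := hs.eval_component_pderiv hfi (by lia) hle
  rw [weightedHomogeneousComponent_pderiv, sub_add_cancel, if_neg (by lia)] at this
  rw [this, zero_sub, apply_ite (-·), neg_zero, mul_ite, mul_zero, mul_neg, neg_mul]
  exact if_congr (by lia) rfl rfl

-- By Euler's identity the sum over `J` of `v i * (-l * x i ^ 2)` vanishes, where `v i` is constant
-- on `J` and nonzero.
theorem exists_isTangentAt (hs : IsFacialSolution f u w₀ v l x) (hf : f ∈ weightGE ℂ v h)
    (hw : h < w₀) : ∃ J : Finset (Fin n),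
      IsTangentAt (weightedHomogeneousComponent v h f) (∑ i ∈ J, X i ^ 2) x := by
  classical
  let J := Finset.univ.filter fun i => 2 * v i = h - w₀
  have hgrad (i) := hs.eval_pderiv_component hf hw i
  have heuler : ∑ i, v i • (x i * if 2 * v i = h - w₀ then -l * x i else 0) = 0 := by
    have := congrArg (eval x) (sum_weight_smul_X_mul_pderiv
      (weightedHomogeneousComponent_isWeightedHomogeneous (w := v) h f))
    simpa only [map_sum, map_zsmul, map_mul, eval_X, hgrad, hs.eval_component hf, smul_zero]
      using this
  have hsum : ∑ i ∈ J, x i ^ 2 = 0 := by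
    have hmul : (h - w₀ : ℂ) * -l * ∑ i ∈ J, x i ^ 2 = 0 :=
      calc (h - w₀ : ℂ) * -l * ∑ i ∈ J, x i ^ 2
          = 2 * ∑ i, v i • (x i * if 2 * v i = h - w₀ then -l * x i else 0) := by
            rw [Finset.sum_filter, Finset.mul_sum, Finset.mul_sum]
            refine Finset.sum_congr rfl fun i _ => ?_
            split_ifs with hi
            · rw [← Int.cast_sub, ← hi, zsmul_eq_mul]
              push_cast
              ring
            · simp only [mul_zero, smul_zero]
        _ = 0 := by rw [heuler, mul_zero]
    refine (mul_eq_zero.1 hmul).resolve_left (mul_ne_zero ?_ (neg_ne_zero.2 hs.multiplier_ne_zero))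
    exact sub_ne_zero.2 (Int.cast_injective.ne hw.ne)
  have hgradJ (i) : eval x (pderiv i (∑ j ∈ J, X j ^ 2)) =
      if 2 * v i = h - w₀ then 2 * x i else 0 := by
    simp [J, pderiv_X, Pi.single_apply, apply_ite (eval x)]
  refine ⟨J, hs.eval_component hf, by simpa using hsum, -l / 2, fun i => ?_⟩
  rw [hgrad, hgradJ, mul_ite, mul_zero]
  congr 1
  ring

end IsFacialSolution

end Facial

theorem not_hasTorusSolution_facialSystem {n : ℕ} {f : MvPolynomial (Fin n) ℂ} {u : Fin n → ℂ}
    (hf₀ : eval 0 f ≠ 0)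
    (htrans : ∀ (v : Fin n → ℤ) (h : ℤ) (J : Finset (Fin n)) (x : Fin n → ℂ), (∀ i, x i ≠ 0) →
      IsTangentAt (weightedHomogeneousComponent v h f) (∑ i ∈ J, X i ^ 2) x →
        weightedHomogeneousComponent v h f = 0)
    (hfu : eval u f ≠ 0) (hcrit : ∀ x, IsCriticalPoint f u x → ∀ i, x i ≠ 0)
    {w : Fin (n + 1) → ℤ} (hw : w ≠ 0) : ¬ HasTorusSolution (facialSystem w (lagrange f u)) := by
  rw [hasTorusSolution_facialSystem_lagrange_iff]
  rintro ⟨l, x, hs⟩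
  set w₀ := w 0
  set v := Fin.tail w
  obtain ⟨h, hf, hfh⟩ := exists_weightedHomogeneousComponent_ne_zero v
    (ne_of_apply_ne (eval 0) (hf₀.trans_eq (map_zero _).symm))
  have hh : h ≤ 0 := by
    rw [eval_zero, constantCoeff_eq, ← mem_support_iff] at hf₀
    simpa using hf hf₀
  rcases lt_or_ge h w₀ with hlt | hle
  · obtain ⟨J, hJ⟩ := hs.exists_isTangentAt hf hlt
    exact hfh (htrans v h J x hs.coord_ne_zero hJ)
  have hv₀ := hs.weight_nonneg hf hle
  rcases (hle.trans hh).lt_or_eq with hneg | hzero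
  · exact hfu (hs.eval_eq_zero_of_neg hv₀ hneg)
  obtain ⟨i, hi⟩ : ∃ i, v i ≠ 0 := by
    by_contra! hall
    exact hw (funext (Fin.cases hzero hall))
  rw [hzero] at hs
  exact hcrit _ (hs.isCriticalPoint hv₀) i (if_neg hi)

section SparsePoly

variable {n : ℕ} {A : Finset (Fin n →₀ ℕ)}

theorem coeff_sparsePoly (c : A → ℂ) (a : A) :
    coeff (a : Fin n →₀ ℕ) (sparsePoly A c) = c a := by
  classical
  simp [sparsePoly, coeff_sum, coeff_monomial]

theorem support_sparsePoly {c : A → ℂ} (hc : ∀ a, c a ≠ 0) : (sparsePoly A c).support = A := by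
  classical
  ext a
  by_cases ha : a ∈ A
  · simpa [ha, mem_support_iff] using (coeff_sparsePoly c ⟨a, ha⟩).trans_ne (hc _)
  · simp only [ha, iff_false, notMem_support_iff, sparsePoly, coeff_sum, coeff_monomial]
    exact Finset.sum_eq_zero fun b _ => if_neg fun h : (b : Fin n →₀ ℕ) = a => ha (h ▸ b.2)

theorem weightedHomogeneousComponent_sparsePoly (c : A → ℂ) (v : Fin n → ℤ) (m : ℤ) :
    weightedHomogeneousComponent v m (sparsePoly A c) =
      ∑ a : A, c a • if Finsupp.weight v (a : Fin n →₀ ℕ) = m then monomial a 1 else 0 := by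
  simp only [sparsePoly, map_sum, weightedHomogeneousComponent_monomial, smul_ite, smul_monomial,
    smul_eq_mul, mul_one, smul_zero]

theorem holdsForGeneral_weightedHomogeneousComponent_eq_zero_of_isTangentAt
    (A : Finset (Fin n →₀ ℕ)) {κ : Type*} [Finite κ] (q : κ → MvPolynomial (Fin n) ℂ) :
    HoldsForGeneral fun c : A → ℂ => ∀ (v : Fin n → ℤ) (h : ℤ) (k : κ) (x : Fin n → ℂ),
      (∀ i, x i ≠ 0) → IsTangentAt (weightedHomogeneousComponent v h (sparsePoly A c)) (q k) x →
        weightedHomogeneousComponent v h (sparsePoly A c) = 0 := by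
  classical
  let p (F : Finset A) (a : A) : MvPolynomial (Fin n) ℂ := if a ∈ F then monomial a 1 else 0
  have hp := HoldsForGeneral.forall fun F => HoldsForGeneral.forall fun k =>
    holdsForGeneral_eval_eq_zero_of_isTangentAt (p F) (q k)
  refine hp.mono fun c hc v h k x hx htan => ?_
  let F : Finset A := Finset.univ.filter fun a => Finsupp.weight v (a : Fin n →₀ ℕ) = h
  have hcF : weightedHomogeneousComponent v h (sparsePoly A c) = ∑ a, c a • p F a := by
    simp only [weightedHomogeneousComponent_sparsePoly, p, F, Finset.mem_filter_univ]
  rw [hcF] at htan ⊢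
  refine Finset.sum_eq_zero fun a _ => ?_
  have ha : a ∉ F := fun ha => by
    have := hc F k x htan a
    simp only [p, if_pos ha, eval_monomial, one_mul] at this
    exact Finsupp.prod_ne_zero_iff.2 (fun i _ => pow_ne_zero _ (hx i)) this
  rw [show p F a = 0 from if_neg ha, smul_zero]

end SparsePoly

end SparseED

open SparseED in
theorem theorem4p2 (n : ℕ) (A : Finset (Fin n →₀ ℕ)) (hA : 0 ∈ A) :
    SparseED.HoldsForGeneral fun c : A → ℂ =>
      (SparseED.sparsePoly A c).support = A ∧
      SparseED.HoldsForGeneral fun u : Fin n → ℂ =>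
        ∀ w : Fin (n + 1) → ℤ, w ≠ 0 →
          ¬ SparseED.HasTorusSolution
            (SparseED.facialSystem w (SparseED.lagrange (SparseED.sparsePoly A c) u)) := by
  have htrans := holdsForGeneral_weightedHomogeneousComponent_eq_zero_of_isTangentAt A
    fun J : Finset (Fin n) => ∑ i ∈ J, MvPolynomial.X i ^ 2
  refine (holdsForGeneral_forall_ne_zero.and htrans).mono fun c ⟨hc, htrans⟩ =>
    ⟨support_sparsePoly hc, ?_⟩
  have hf₀ : MvPolynomial.eval 0 (sparsePoly A c) ≠ 0 := by
    rw [MvPolynomial.eval_zero, MvPolynomial.constantCoeff_eq]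
    exact (coeff_sparsePoly c ⟨0, hA⟩).trans_ne (hc _)
  have hf : sparsePoly A c ≠ 0 := ne_of_apply_ne (MvPolynomial.eval 0) (by rwa [map_zero])
  refine ((holdsForGeneral_eval_ne_zero hf).and
    (holdsForGeneral_criticalPoint_coord_ne_zero hf₀)).mono fun u ⟨hfu, hcrit⟩ w hw => ?_
  exact not_hasTorusSolution_facialSystem hf₀ htrans hfu hcrit hw
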